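/- Let $q$ be a power of an odd prime, let $G=\mathrm{PSL}(2,q^2)$, let $M$ be a maximal subgroup of $G$ isomorphic to $\mathrm{PGL}(2,q)$, and let $g\in M$ be a nontrivial unipotent element, i.e. $g\neq 1$ is the image in $G$ of a unipotent matrix of $\mathrm{SL}(2,q^2)$. Write $g^G$ for the conjugacy class of $g$ in $G$, $m^y=y^{-1}my$, and $C_M(x)$ for the centralizer of $x$ in $M$. A $1$-$(v,k,\lambda)$ design is a pair $(\mathcal P,\mathcal B)$ where $\mathcal P$ is a set of $v$ points and $\mathcal B$ is a set of $k$-element subsets of $\mathcal P$ (blocks) such that every point lies in exactly $\lambda$ blocks. Let $\mathcal D=(\mathcal P,\mathcal B)$ with $\mathcal P=g^G$ and $\mathcal B=\{(M\cap g^G)^y : y\in G\}$. For $x\in\mathcal P$ let $I_x$ be the intersection of all blocks of $\mathcal D$ containing $x$, and let $\mathcal D_I=(\mathcal P_I,\mathcal B_I)$ with $\mathcal P_I=\{I_x : x\in\mathcal P\}$ and $\mathcal B_I=\{\bar B : B\in\mathcal B\}$, where $\bar B=\{J\in\mathcal P_I : J\subseteq B\}$. Then: (a) $\mathcal D$ is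 a $1$-$\left(\frac{q^4-1}{2},\,q^2-1,\,q\right)$ design; (b) $|I_x|=q-1$ for all $x\in g^G$; (c) $I_x=C_M(x)\cap g^G$ for all $x\in M\cap g^G$; (d) the reduced design $\mathcal D_I$ is a $1$-$\left(\frac{(q^2+1)(q+1)}{2},\,q+1,\,q\right)$ design. -/

import Mathlib

/-- An incidence structure whose points are the elements of a set and whose blocks are sets of
points, with incidence being membership. -/
structure BlockStructure (α : Type*) where
  points : Set α
  blocks : Set (Set α)

namespace BlockStructure

variable {α : Type*}

/-- The structure `D` is a `1`-`(v, k, l)` design: there are `v` points, every block is a set of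
`k` points, and every point lies in exactly `l` blocks. -/
structure IsOneDesign (D : BlockStructure α) (v k l : ℕ) : Prop where
  finite_points : D.points.Finite
  card_points : D.points.ncard = v
  block_subset : ∀ B ∈ D.blocks, B ⊆ D.points
  card_block : ∀ B ∈ D.blocks, B.ncard = k
  card_blocks_through : ∀ x ∈ D.points, {B | B ∈ D.blocks ∧ x ∈ B}.ncard = l

/-- The set `I_x`: the intersection of all blocks containing `x` (taken inside the point set). -/
def fiber (D : BlockStructure α) (x : α) : Set α :=
  D.points ∩ ⋂₀ {B | B ∈ D.blocks ∧ x ∈ B}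

/-- The reduced structure `D_I`: its points are the sets `I_x` for `x` a point of `D`, and its
blocks are the sets `{I_x : I_x ⊆ B}` for `B` a block of `D`. -/
def reduced (D : BlockStructure α) : BlockStructure (Set α) where
  points := D.fiber '' D.points
  blocks := (fun B => {J | J ∈ D.fiber '' D.points ∧ J ⊆ B}) '' D.blocks

end BlockStructure

/-- The Method-2 structure of a subgroup `M` of `G` and an element `g`: the points are the
elements of the conjugacy class `g^G`, the blocks are the conjugates `(M ∩ g^G)^y`, `y ∈ G`,
where `m^y = y⁻¹ m y`. -/
def methodTwo {G : Type*} [Group G] (M : Subgroup G) (g : G) : BlockStructure G where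
  points := conjugatesOf g
  blocks := Set.range fun y : G => (fun m => y⁻¹ * m * y) '' ((M : Set G) ∩ conjugatesOf g)

/-- An element of `PSL(2, F)` is unipotent if it is the image of a unipotent matrix
of `SL(2, F)`, that is, of a matrix `A` with `A - 1` nilpotent. -/
def PSLIsUnipotent {F : Type*} [Field F]
    (g : Matrix.ProjectiveSpecialLinearGroup (Fin 2) F) : Prop :=
  ∃ A : Matrix.SpecialLinearGroup (Fin 2) F,
    IsNilpotent ((A : Matrix (Fin 2) (Fin 2) F) - 1) ∧
      (QuotientGroup.mk A : Matrix.ProjectiveSpecialLinearGroup (Fin 2) F) = g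

/-!
The argument uses only a few facts about centralizers of unipotent elements.

In `PGL(2, R)`, with `R` a field in which `2 ≠ 0`, the centralizer of the image of `1 + N`, where
`N ≠ 0` is nilpotent, is the one-parameter group `b ↦ 1 + b N`: a matrix commuting with `1 + N` up
to a scalar commutes with it exactly, because `1 + N` has trace `2 ≠ 0`, and the matrices commuting
with `N` are the `a + b N` (`Matrix.ProjGenLinGroup.commute_unipotent_iff`). So this centralizer is
abelian of order `|R|`, and it is also the centralizer of each of its nontrivial elements. Through
the embedding of `PSL(2, F)` in `PGL(2, F)` the same holds in `G = PSL(2, F)`, where the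
centralizer of `g` has order `q ^ 2`. In `PGL(2, K)` all elements of order `p`, the characteristic,
are unipotent and conjugate, so `M ∩ g^G` is a single class of `M`, consisting of all elements of
order `p` of `M`.
The predicate `IsFusedPair` records these facts, and everything else is proved from them for an
abstract finite group.

A block is identified with the set of `z` in `g^G` such that `y z y⁻¹ ∈ M`. If `y g y⁻¹ ∈ M`, then
by fusion `y` may be changed on the left by an element of `M` so as to centralize `g`. Hence the
blocks through `g` are the conjugates of `M ∩ g^G` by `C_G(g)`. By maximality `M` is the whole
stabilizer of `M ∩ g^G`, so there are `[C_G(g) : C_M(g)] = q` of them. As `C_G(g)` is abelian, each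
of these blocks contains `C_M(g) \ {1}`. Conversely, if `z` lies in all of them, then `M ∩ g^G`
contains every conjugate of `z` under `C_G(g)`. If `z` did not commute with `g`, these would be
`q ^ 2` distinct elements, while `|M ∩ g^G| = q ^ 2 - 1`. Thus `I_g = C_M(g) \ {1}`
(`IsFusedPair.fiber_self`), and conjugation gives all the other `I_x`. The sets `I_x` have
size `q - 1` and partition both the point set and every block, and a block is the union of the
`I_x` it contains. This gives the parameters of the reduced structure.
-/

/-! ### Counting lemmas -/

/-- Orbit-stabilizer for a subgroup acting by conjugation on an element of the ambient group. -/
theorem Subgroup.ncard_conj_image_mul_card_centralizer {G : Type*} [Group G] [Finite G]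
    (H : Subgroup G) (g : G) :
    ((fun h => h * g * h⁻¹) '' (H : Set G)).ncard *
      Nat.card (H ⊓ Subgroup.centralizer {g} : Subgroup G) = Nat.card H := by
  let _ : MulAction H G := MulAction.compHom G (MulAut.conj.comp H.subtype)
  have horb : MulAction.orbit H g = (fun h => h * g * h⁻¹) '' (H : Set G) := by
    ext x
    constructor
    · rintro ⟨h, rfl⟩
      exact ⟨h, h.2, rfl⟩
    · rintro ⟨h, hh, rfl⟩
      exact ⟨⟨h, hh⟩, rfl⟩
  have hstab : (MulAction.stabilizer H g).map H.subtype = H ⊓ Subgroup.centralizer {g} := by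
    ext x
    simp only [Subgroup.mem_map, MulAction.mem_stabilizer_iff, Subgroup.mem_inf,
      Subgroup.mem_centralizer_singleton_iff]
    constructor
    · rintro ⟨h, hh, rfl⟩
      exact ⟨h.2, mul_inv_eq_iff_eq_mul.1 hh⟩
    · rintro ⟨hx, hc⟩
      exact ⟨⟨x, hx⟩, mul_inv_eq_iff_eq_mul.2 hc, rfl⟩
  rw [← horb, ← hstab, Subgroup.card_map_of_injective H.subtype_injective, ← Nat.card_coe_set_eq,
    ← Nat.card_prod]
  exact Nat.card_congr (MulAction.orbitProdStabilizerEquivGroup H g)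

/-- If the sets `f x`, for `x ∈ S`, partition `S` into classes of size `k`, then there are
`|S| / k` classes. -/
theorem Set.ncard_image_mul_of_partition {α : Type*} {S : Set α} (hS : S.Finite)
    (f : α → Set α) {k : ℕ} (hk : ∀ x ∈ S, (f x).ncard = k)
    (hsub : ∀ x ∈ S, f x ⊆ S) (hself : ∀ x ∈ S, x ∈ f x)
    (heq : ∀ x ∈ S, ∀ z ∈ f x, f z = f x) :
    (f '' S).ncard * k = S.ncard := by
  classical
  lift S to Finset α using hS
  rw [Set.ncard_coe_finset, ← Finset.coe_image, Set.ncard_coe_finset,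
    Finset.card_eq_sum_card_image f S, Finset.sum_const_nat (m := k)]
  intro J hJ
  obtain ⟨x, hx, rfl⟩ := Finset.mem_image.1 hJ
  rw [← hk x hx, ← Set.ncard_coe_finset]
  congr 1
  ext z
  simp only [Finset.coe_filter, Set.mem_ofPred_eq]
  constructor
  · rintro ⟨hz, h⟩
    exact h ▸ hself z hz
  · intro hz
    exact ⟨hsub x hx hz, heq x hx z hz⟩

/-! ### The abstract hypotheses -/

/-- What the parameter count needs to know about `M ≅ PGL(2, q)` inside `G = PSL(2, q ^ 2)` and a
nontrivial unipotent `g ∈ M`: the orders of the groups and of the centralizers of `g`, the fact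
that elements with a common nontrivial commuting element `w` in the centralizer of `g` commute with
each other, and the fusion of `M ∩ g^G` into one conjugacy class of `M`. -/
structure IsFusedPair {G : Type*} [Group G] (M : Subgroup G) (g : G) (q : ℕ) : Prop where
  one_lt : 1 < q
  mem : g ∈ M
  isCoatom : IsCoatom M
  ne_one : g ≠ 1
  commute_of_commute_commute : ∀ w, w ≠ 1 → Commute w g →
    ∀ a b, Commute a w → Commute b w → Commute a b
  card_centralizer : Nat.card (Subgroup.centralizer {g}) = q ^ 2
  two_mul_card : 2 * Nat.card G = q ^ 2 * (q ^ 4 - 1)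
  card_inf_centralizer : Nat.card (M ⊓ Subgroup.centralizer {g} : Subgroup G) = q
  card_subgroup : Nat.card M = q * (q ^ 2 - 1)
  exists_conj : ∀ x ∈ M, IsConj g x → ∃ m ∈ M, m * g * m⁻¹ = x
  isConj_of_commute : ∀ x ∈ M, x ≠ 1 → Commute x g → IsConj g x

/-! ### Blocks and fibers of the structure attached to a subgroup and a class -/

section Block

variable {G : Type*} [Group G] {M : Subgroup G} {g : G}

/-- The block `(M ∩ g^G)^y`, described by the condition `y z y⁻¹ ∈ M` on its elements `z`. -/
def methodTwoBlock (M : Subgroup G) (g y : G) : Set G :=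
  {z | y * z * y⁻¹ ∈ M ∧ IsConj g z}

theorem mem_methodTwoBlock {y z : G} :
    z ∈ methodTwoBlock M g y ↔ y * z * y⁻¹ ∈ M ∧ IsConj g z := Iff.rfl

theorem isConj_conj_iff {g y z : G} : IsConj g (y * z * y⁻¹) ↔ IsConj g z := by
  have h : IsConj z (y * z * y⁻¹) := isConj_iff.2 ⟨y, rfl⟩
  exact ⟨fun h' => h'.trans h.symm, fun h' => h'.trans h⟩

theorem image_conj_eq_methodTwoBlock (M : Subgroup G) (g y : G) :
    (fun m => y⁻¹ * m * y) '' ((M : Set G) ∩ conjugatesOf g) = methodTwoBlock M g y := by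
  ext z
  constructor
  · rintro ⟨m, ⟨hm, hgm⟩, rfl⟩
    have h : y * (y⁻¹ * m * y) * y⁻¹ = m := by group
    exact ⟨h.symm ▸ hm, (isConj_conj_iff (y := y)).1 (h.symm ▸ hgm)⟩
  · rintro ⟨hz, hgz⟩
    exact ⟨y * z * y⁻¹, ⟨hz, isConj_conj_iff.2 hgz⟩, by group⟩

theorem blocks_methodTwo : (methodTwo M g).blocks = Set.range (methodTwoBlock M g) := by
  simp only [methodTwo, image_conj_eq_methodTwoBlock]

theorem methodTwoBlock_one : methodTwoBlock M g 1 = (M : Set G) ∩ conjugatesOf g := by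
  rw [← image_conj_eq_methodTwoBlock]; simp

theorem ncard_methodTwoBlock (M : Subgroup G) (g y : G) :
    (methodTwoBlock M g y).ncard = (methodTwoBlock M g 1).ncard := by
  rw [← image_conj_eq_methodTwoBlock, methodTwoBlock_one]
  exact Set.ncard_image_of_injective _ fun a b h => by simpa using h

theorem methodTwoBlock_mul {m y : G} (hm : m ∈ M) :
    methodTwoBlock M g (m * y) = methodTwoBlock M g y := by
  ext z
  have h : m * y * z * (m * y)⁻¹ = m * (y * z * y⁻¹) * m⁻¹ := by group
  rw [mem_methodTwoBlock, mem_methodTwoBlock, h, M.mul_mem_cancel_right (M.inv_mem hm),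
    M.mul_mem_cancel_left hm]

theorem conj_mem_methodTwoBlock {d y z : G} :
    d * z * d⁻¹ ∈ methodTwoBlock M g y ↔ z ∈ methodTwoBlock M g (y * d) := by
  rw [mem_methodTwoBlock, mem_methodTwoBlock, isConj_conj_iff]
  have h : y * (d * z * d⁻¹) * y⁻¹ = y * d * z * (y * d)⁻¹ := by group
  rw [h]

theorem methodTwoBlock_mul_right_cancel {y y' d : G}
    (h : methodTwoBlock M g (y * d) = methodTwoBlock M g (y' * d)) :
    methodTwoBlock M g y = methodTwoBlock M g y' := by
  ext z
  have h1 : z = d * (d⁻¹ * z * d) * d⁻¹ := by group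
  rw [h1, conj_mem_methodTwoBlock, conj_mem_methodTwoBlock, h]

theorem mem_fiber_methodTwo {x z : G} (hx : IsConj g x) :
    z ∈ (methodTwo M g).fiber x ↔
      IsConj g z ∧ ∀ y, y * x * y⁻¹ ∈ M → y * z * y⁻¹ ∈ M := by
  simp only [BlockStructure.fiber, Set.mem_inter_iff, Set.mem_sInter, Set.mem_ofPred_eq,
    blocks_methodTwo, and_imp, Set.forall_mem_range, mem_methodTwoBlock]
  exact and_congr_right fun hz => ⟨fun h y hy => (h y hy hx).1, fun h y hy _ => ⟨h y hy, hz⟩⟩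

/-- Conjugation by `d` is an automorphism of the structure, so it carries `I_x` to
`I_{d x d⁻¹}`. -/
theorem conj_mem_fiber_methodTwo {d x z : G} (hx : IsConj g x) :
    d * z * d⁻¹ ∈ (methodTwo M g).fiber (d * x * d⁻¹) ↔ z ∈ (methodTwo M g).fiber x := by
  rw [mem_fiber_methodTwo hx, mem_fiber_methodTwo (isConj_conj_iff.2 hx), isConj_conj_iff]
  refine and_congr_right fun _ => ⟨fun h y => ?_, fun h y => ?_⟩
  · have := h (y * d⁻¹)
    have e (w : G) : y * d⁻¹ * (d * w * d⁻¹) * (y * d⁻¹)⁻¹ = y * w * y⁻¹ := by group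
    simpa only [e] using this
  · have := h (y * d)
    have e (w : G) : y * (d * w * d⁻¹) * y⁻¹ = y * d * w * (y * d)⁻¹ := by group
    simpa only [e] using this

theorem self_mem_fiber_methodTwo {x : G} (hx : IsConj g x) : x ∈ (methodTwo M g).fiber x :=
  (mem_fiber_methodTwo hx).2 ⟨hx, fun _ => id⟩

theorem fiber_subset_block {x : G} {B : Set G} (hB : B ∈ (methodTwo M g).blocks) (hx : x ∈ B) :
    (methodTwo M g).fiber x ⊆ B :=
  fun _ hz => hz.2 B ⟨hB, hx⟩

end Block

/-! ### Parameters of the design and of its reduction -/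

namespace IsFusedPair

variable {G : Type*} [Group G] {M : Subgroup G} {g : G} {q : ℕ}

theorem commute_of_commute (h : IsFusedPair M g q) (a b : G) (ha : Commute a g)
    (hb : Commute b g) : Commute a b :=
  h.commute_of_commute_commute g h.ne_one (Commute.refl g) a b ha hb

theorem two_mul_ncard_conjugates [Finite G] (h : IsFusedPair M g q) :
    2 * (conjugatesOf g).ncard = q ^ 4 - 1 := by
  have h1 := Subgroup.ncard_conj_image_mul_card_centralizer (⊤ : Subgroup G) g
  have h2 : (fun h => h * g * h⁻¹) '' ((⊤ : Subgroup G) : Set G) = conjugatesOf g := by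
    ext x
    simp [conjugatesOf, isConj_iff]
  rw [h2, top_inf_eq, h.card_centralizer, Subgroup.card_top] at h1
  have h3 := h.two_mul_card
  have : 0 < q ^ 2 := by have := h.one_lt; positivity
  rw [← h1] at h3
  exact Nat.eq_of_mul_eq_mul_left this (by linarith)

theorem ncard_methodTwoBlock [Finite G] (h : IsFusedPair M g q) (y : G) :
    (methodTwoBlock M g y).ncard = q ^ 2 - 1 := by
  have h1 := Subgroup.ncard_conj_image_mul_card_centralizer M g
  have h2 : (fun h => h * g * h⁻¹) '' (M : Set G) = methodTwoBlock M g 1 := by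
    ext x
    rw [methodTwoBlock_one]
    constructor
    · rintro ⟨m, hm, rfl⟩
      exact ⟨M.mul_mem (M.mul_mem hm h.mem) (M.inv_mem hm), isConj_iff.2 ⟨m, rfl⟩⟩
    · rintro ⟨hx, hgx⟩
      exact h.exists_conj x hx hgx
  rw [h2, h.card_inf_centralizer, h.card_subgroup, mul_comm] at h1
  rw [_root_.ncard_methodTwoBlock]
  exact Nat.eq_of_mul_eq_mul_left (by have := h.one_lt; omega) h1

/-- The setwise stabilizer of `M ∩ g^G` is `M`: it contains the maximal subgroup `M`, and it is
not `G` since `M ∩ g^G` is smaller than `g^G`. -/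
theorem mem_of_methodTwoBlock_eq [Finite G] (h : IsFusedPair M g q) {y : G}
    (hy : methodTwoBlock M g y = methodTwoBlock M g 1) : y ∈ M := by
  let N : Subgroup G :=
    { carrier := {y | methodTwoBlock M g y = methodTwoBlock M g 1}
      one_mem' := rfl
      mul_mem' := by
        intro a b ha hb
        rw [Set.mem_ofPred_eq] at *
        rw [← hb]
        refine methodTwoBlock_mul_right_cancel (d := b⁻¹) ?_
        simpa using ha
      inv_mem' := by
        intro a ha
        rw [Set.mem_ofPred_eq] at *
        refine methodTwoBlock_mul_right_cancel (d := a) ?_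
        simpa using ha.symm }
  have hMN : M ≤ N := fun m hm => by
    have := methodTwoBlock_mul (g := g) (y := 1) hm
    rwa [mul_one] at this
  rcases h.isCoatom.le_iff.1 hMN with hN | hN
  · have hsub : conjugatesOf g ⊆ methodTwoBlock M g 1 := by
      intro x hx
      obtain ⟨c, rfl⟩ := isConj_iff.1 hx
      have hc : c ∈ N := hN ▸ Subgroup.mem_top c
      have hc' : methodTwoBlock M g c = methodTwoBlock M g 1 := hc
      rw [conj_mem_methodTwoBlock, one_mul, hc', methodTwoBlock_one]
      exact ⟨h.mem, mem_conjugatesOf_self⟩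
    have h1 := Set.ncard_le_ncard hsub
    rw [h.ncard_methodTwoBlock] at h1
    have h2 := h.two_mul_ncard_conjugates
    have h3 : 4 ≤ q ^ 2 := Nat.pow_le_pow_left h.one_lt 2
    have h4 : q ^ 4 = q ^ 2 * q ^ 2 := by ring
    have h5 : 4 * q ^ 2 ≤ q ^ 2 * q ^ 2 := Nat.mul_le_mul_right _ h3
    omega
  · exact hN ▸ hy

theorem methodTwoBlock_eq_iff [Finite G] (h : IsFusedPair M g q) {y y' : G} :
    methodTwoBlock M g y = methodTwoBlock M g y' ↔ y * y'⁻¹ ∈ M := by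
  constructor
  · intro hy
    refine h.mem_of_methodTwoBlock_eq (methodTwoBlock_mul_right_cancel (d := y') ?_)
    simpa using hy
  · intro hm
    simpa using methodTwoBlock_mul (g := g) (y := y') hm

/-- By fusion in `M`, any `y` that conjugates `g` into `M` lies in `M C_G(g)`. -/
theorem exists_mul_commute (h : IsFusedPair M g q) {y : G} (hy : y * g * y⁻¹ ∈ M) :
    ∃ m ∈ M, Commute (m * y) g := by
  obtain ⟨m, hm, hmy⟩ := h.exists_conj _ hy (isConj_iff.2 ⟨y, rfl⟩)
  refine ⟨m⁻¹, M.inv_mem hm, ?_⟩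
  have h1 : m⁻¹ * y * g * (m⁻¹ * y)⁻¹ = g := by
    have : m⁻¹ * y * g * (m⁻¹ * y)⁻¹ = m⁻¹ * (y * g * y⁻¹) * m := by group
    rw [this, ← hmy]; group
  exact mul_inv_eq_iff_eq_mul.1 h1

/-- The blocks through `d g d⁻¹` correspond to the cosets of `C_M(g)` in `C_G(g)`. -/
theorem ncard_blocks_through [Finite G] (h : IsFusedPair M g q) {x : G} (hx : IsConj g x) :
    {B | B ∈ (methodTwo M g).blocks ∧ x ∈ B}.ncard = q := by
  obtain ⟨d, rfl⟩ := isConj_iff.1 hx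
  set C := Subgroup.centralizer {g} with hC
  have hCmem {c : G} : c ∈ C ↔ Commute c g := by
    rw [hC, Subgroup.mem_centralizer_singleton_iff]; rfl
  -- The inverse turns the left cosets `c C_M(g)` into elements that differ by `M` on the left.
  let f : C ⧸ M.subgroupOf C → Set G :=
    Quotient.lift (fun c : C => methodTwoBlock M g ((c : G)⁻¹ * d⁻¹)) (by
      intro a b hab
      rw [h.methodTwoBlock_eq_iff]
      have := QuotientGroup.leftRel_apply.1 hab
      rw [Subgroup.mem_subgroupOf] at this
      simpa [mul_assoc] using this)
  have hf : Function.Injective f := by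
    rintro ⟨a⟩ ⟨b⟩ hab
    have := h.methodTwoBlock_eq_iff.1 hab
    refine QuotientGroup.eq.2 ?_
    rw [Subgroup.mem_subgroupOf]
    simpa [mul_assoc] using this
  have hrange : Set.range f = {B | B ∈ (methodTwo M g).blocks ∧ d * g * d⁻¹ ∈ B} := by
    ext B
    rw [blocks_methodTwo]
    constructor
    · rintro ⟨⟨c⟩, rfl⟩
      refine ⟨⟨_, rfl⟩, ?_⟩
      refine conj_mem_methodTwoBlock.2 ⟨?_, IsConj.refl g⟩
      have hc : Commute (c : G)⁻¹ g := (hCmem.1 c.2).inv_left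
      have : (c : G)⁻¹ * d⁻¹ * d * g * ((c : G)⁻¹ * d⁻¹ * d)⁻¹ = g := by
        rw [inv_mul_cancel_right, hc.eq, mul_inv_cancel_right]
      rw [this]
      exact h.mem
    · rintro ⟨⟨y, rfl⟩, hy⟩
      obtain ⟨m, hm, hc⟩ := h.exists_mul_commute (conj_mem_methodTwoBlock.1 hy).1
      refine ⟨QuotientGroup.mk ⟨(m * (y * d))⁻¹, hCmem.2 hc.inv_left⟩, ?_⟩
      refine Eq.trans ?_ (methodTwoBlock_mul hm)
      change methodTwoBlock M g _ = _
      congr 1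
      group
  rw [← hrange, ← Nat.card_coe_set_eq, Nat.card_range_of_injective hf]
  have h1 := Subgroup.card_eq_card_quotient_mul_card_subgroup (M.subgroupOf C)
  have h2 : Nat.card (M.subgroupOf C) = q := by
    rw [← h.card_inf_centralizer, ← Subgroup.inf_subgroupOf_right]
    exact Nat.card_congr (Subgroup.subgroupOfEquivOfLe inf_le_right).toEquiv
  rw [h2, h.card_centralizer, pow_two] at h1
  exact (Nat.eq_of_mul_eq_mul_right (by have := h.one_lt; omega) h1).symm

/-- A point lying in all blocks through `g` commutes with `g`: otherwise its conjugates under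
`C_G(g)` would be `q ^ 2` points of the block `M ∩ g^G`. -/
theorem fiber_self [Finite G] (h : IsFusedPair M g q) :
    (methodTwo M g).fiber g =
      ((M ⊓ Subgroup.centralizer {g} : Subgroup G) : Set G) ∩ conjugatesOf g := by
  ext z
  rw [mem_fiber_methodTwo (IsConj.refl g), Set.mem_inter_iff, conjugatesOf, Set.mem_ofPred_eq,
    and_comm, SetLike.mem_coe, Subgroup.mem_inf, Subgroup.mem_centralizer_singleton_iff]
  refine and_congr_left fun hgz => ⟨fun hz => ?_, fun hz y hy => ?_⟩
  · refine ⟨by simpa using hz 1 (by simpa using h.mem), ?_⟩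
    by_contra hne
    have h1 := Subgroup.ncard_conj_image_mul_card_centralizer (Subgroup.centralizer {g}) z
    -- A nontrivial element centralizing both `g` and `z` would force them to commute.
    have hbot : Subgroup.centralizer {g} ⊓ Subgroup.centralizer {z} = ⊥ := by
      rw [eq_bot_iff]
      intro w hw
      rw [Subgroup.mem_inf, Subgroup.mem_centralizer_singleton_iff,
        Subgroup.mem_centralizer_singleton_iff] at hw
      rw [Subgroup.mem_bot]
      by_contra hw1
      exact hne (h.commute_of_commute_commute w hw1 hw.1 z g
        (Commute.symm hw.2) (Commute.symm hw.1))
    have hsub : (fun c => c * z * c⁻¹) '' (Subgroup.centralizer {g} : Set G) ⊆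
        methodTwoBlock M g 1 := by
      rintro _ ⟨c, hc, rfl⟩
      rw [SetLike.mem_coe, Subgroup.mem_centralizer_singleton_iff] at hc
      rw [methodTwoBlock_one]
      exact ⟨hz c (by rw [hc, mul_inv_cancel_right]; exact h.mem), isConj_conj_iff.2 hgz⟩
    have h2 := Set.ncard_le_ncard hsub
    rw [hbot, Subgroup.card_bot, mul_one, h.card_centralizer] at h1
    rw [h1, h.ncard_methodTwoBlock] at h2
    have : 0 < q ^ 2 := by have := h.one_lt; positivity
    omega
  · obtain ⟨m, hm, hc⟩ := h.exists_mul_commute hy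
    have hcz := h.commute_of_commute _ _ hc hz.2
    have e : y * z * y⁻¹ = m⁻¹ * z * m := by
      have : m * y * z * (m * y)⁻¹ = z := by rw [hcz.eq, mul_inv_cancel_right]
      calc y * z * y⁻¹ = m⁻¹ * (m * y * z * (m * y)⁻¹) * m := by group
        _ = _ := by rw [this]
    rw [e]
    exact M.mul_mem (M.mul_mem (M.inv_mem hm) hz.1) hm

theorem fiber_eq [Finite G] (h : IsFusedPair M g q) {x : G} (hxM : x ∈ M) (hx : IsConj g x) :
    (methodTwo M g).fiber x =
      ((M ⊓ Subgroup.centralizer {x} : Subgroup G) : Set G) ∩ conjugatesOf g := by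
  obtain ⟨m, hm, rfl⟩ := h.exists_conj x hxM hx
  ext z
  obtain ⟨w, rfl⟩ : ∃ w, m * w * m⁻¹ = z := ⟨m⁻¹ * z * m, by group⟩
  rw [conj_mem_fiber_methodTwo (IsConj.refl g), h.fiber_self]
  simp only [Set.mem_inter_iff, SetLike.mem_coe, Subgroup.mem_inf, conjugatesOf,
    Set.mem_ofPred_eq, Subgroup.mem_centralizer_singleton_iff, isConj_conj_iff,
    M.mul_mem_cancel_right (M.inv_mem hm), M.mul_mem_cancel_left hm]
  have : m * w * m⁻¹ * (m * g * m⁻¹) = m * g * m⁻¹ * (m * w * m⁻¹) ↔ w * g = g * w :=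
    (Commute.conj_iff m : Commute (m * w * m⁻¹) (m * g * m⁻¹) ↔ Commute w g)
  rw [this]

theorem ncard_fiber [Finite G] (h : IsFusedPair M g q) {x : G} (hx : IsConj g x) :
    ((methodTwo M g).fiber x).ncard = q - 1 := by
  obtain ⟨d, rfl⟩ := isConj_iff.1 hx
  have himage : (methodTwo M g).fiber (d * g * d⁻¹) =
      (fun z => d * z * d⁻¹) '' (methodTwo M g).fiber g := by
    ext z
    obtain ⟨w, rfl⟩ : ∃ w, d * w * d⁻¹ = z := ⟨d⁻¹ * z * d, by group⟩
    rw [conj_mem_fiber_methodTwo (IsConj.refl g)]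
    constructor
    · exact fun hw => ⟨w, hw, rfl⟩
    · rintro ⟨w', hw', he⟩
      have : w' = w := by simpa using he
      exact this ▸ hw'
  have hself : (methodTwo M g).fiber g =
      ((M ⊓ Subgroup.centralizer {g} : Subgroup G) : Set G) \ {1} := by
    rw [h.fiber_self]
    ext z
    rw [Set.mem_inter_iff, Set.mem_sdiff, Set.mem_singleton_iff, SetLike.mem_coe, Subgroup.mem_inf,
      Subgroup.mem_centralizer_singleton_iff]
    refine and_congr_right fun hz => ⟨?_, fun hz1 => h.isConj_of_commute z hz.1 hz1 hz.2⟩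
    rintro hgz rfl
    exact h.ne_one (isConj_one_left.1 hgz)
  rw [himage, Set.ncard_image_of_injective _ fun a b hab => by simpa using hab, hself,
    Set.ncard_sdiff_singleton_of_mem (one_mem _), ← Nat.card_coe_set_eq]
  exact congrArg (· - 1) h.card_inf_centralizer

theorem fiber_eq_of_mem [Finite G] (h : IsFusedPair M g q) {x z : G} (hx : IsConj g x)
    (hz : z ∈ (methodTwo M g).fiber x) : (methodTwo M g).fiber z = (methodTwo M g).fiber x := by
  have hgz : IsConj g z := hz.1
  -- The inclusion `I_z ⊆ I_x` is formal, and the two sets have the same size.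
  refine Set.eq_of_subset_of_ncard_le ?_ ?_ (Set.toFinite _)
  · intro w hw
    rw [mem_fiber_methodTwo hgz] at hw
    rw [mem_fiber_methodTwo hx] at hz ⊢
    exact ⟨hw.1, fun y hy => hw.2 y (hz.2 y hy)⟩
  · rw [h.ncard_fiber hx, h.ncard_fiber hgz]

theorem isOneDesign [Finite G] (h : IsFusedPair M g q) :
    (methodTwo M g).IsOneDesign ((q ^ 4 - 1) / 2) (q ^ 2 - 1) q where
  finite_points := Set.toFinite _
  card_points := by
    have : (conjugatesOf g).ncard = (q ^ 4 - 1) / 2 := by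
      have := h.two_mul_ncard_conjugates
      omega
    exact this
  block_subset B hB := by
    rw [blocks_methodTwo] at hB
    obtain ⟨y, rfl⟩ := hB
    exact fun z hz => hz.2
  card_block B hB := by
    rw [blocks_methodTwo] at hB
    obtain ⟨y, rfl⟩ := hB
    exact h.ncard_methodTwoBlock y
  card_blocks_through x hx := h.ncard_blocks_through hx

theorem reduced_isOneDesign [Finite G] (h : IsFusedPair M g q) :
    (methodTwo M g).reduced.IsOneDesign ((q ^ 2 + 1) * (q + 1) / 2) (q + 1) q := by
  set D := methodTwo M g with hD
  have hq := h.one_lt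
  have hcount {S : Set G} (hS : S ⊆ D.points) (hfS : ∀ x ∈ S, D.fiber x ⊆ S) :
      (D.fiber '' S).ncard * (q - 1) = S.ncard :=
    Set.ncard_image_mul_of_partition (Set.toFinite S) D.fiber
      (fun x hx => h.ncard_fiber (hS hx)) hfS (fun x hx => self_mem_fiber_methodTwo (hS hx))
      (fun x hx z hz => h.fiber_eq_of_mem (hS hx) hz)
  have hblock {B : Set G} (hB : B ∈ D.blocks) :
      {J | J ∈ D.fiber '' D.points ∧ J ⊆ B} = D.fiber '' B := by
    ext J
    constructor
    · rintro ⟨⟨x, hx, rfl⟩, hJ⟩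
      exact ⟨x, hJ (self_mem_fiber_methodTwo hx), rfl⟩
    · rintro ⟨x, hx, rfl⟩
      exact ⟨⟨x, h.isOneDesign.block_subset B hB hx, rfl⟩, fiber_subset_block hB hx⟩
  -- Writing `q = r + 1` turns the truncated subtractions into polynomial identities in `r`.
  obtain ⟨r, rfl⟩ : ∃ r, q = r + 1 := ⟨q - 1, by omega⟩
  have hr : 0 < r := by omega
  refine ⟨Set.toFinite _, ?_, ?_, ?_, ?_⟩
  · have h1 := hcount subset_rfl (fun x _ => Set.inter_subset_left)
    have h2 : 2 * D.points.ncard = (r + 1) ^ 4 - 1 := h.two_mul_ncard_conjugates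
    have h3 : (r + 1) ^ 4 - 1 = ((r + 1) ^ 2 + 1) * (r + 1 + 1) * r :=
      Nat.sub_eq_of_eq_add (by ring)
    rw [← h1, h3, Nat.add_sub_cancel, ← mul_assoc] at h2
    have h4 := Nat.eq_of_mul_eq_mul_right hr h2
    change (D.fiber '' D.points).ncard = _
    omega
  · rintro _ ⟨B, hB, rfl⟩
    exact fun J hJ => hJ.1
  · rintro _ ⟨B, hB, rfl⟩
    have h1 := hcount (h.isOneDesign.block_subset B hB) (fun x hx => fiber_subset_block hB hx)
    rw [h.isOneDesign.card_block B hB] at h1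
    have h3 : (r + 1) ^ 2 - 1 = (r + 1 + 1) * r := Nat.sub_eq_of_eq_add (by ring)
    rw [h3, Nat.add_sub_cancel] at h1
    refine (congrArg Set.ncard (hblock hB)).trans ?_
    exact Nat.eq_of_mul_eq_mul_right hr h1
  · rintro _ ⟨x, hx, rfl⟩
    have hset : {B | B ∈ D.reduced.blocks ∧ D.fiber x ∈ B} =
        (fun B => {J | J ∈ D.fiber '' D.points ∧ J ⊆ B}) '' {B | B ∈ D.blocks ∧ x ∈ B} := by
      ext C
      constructor
      · rintro ⟨⟨B, hB, rfl⟩, hxB⟩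
        exact ⟨B, ⟨hB, hxB.2 (self_mem_fiber_methodTwo hx)⟩, rfl⟩
      · rintro ⟨B, ⟨hB, hxB⟩, rfl⟩
        exact ⟨⟨B, hB, rfl⟩, ⟨x, hx, rfl⟩, fiber_subset_block hB hxB⟩
    rw [hset, Set.InjOn.ncard_image, h.ncard_blocks_through hx]
    -- A block is recovered from its reduction as the union of the fibers it contains.
    have hsub {B B' : Set G} (hB : B ∈ D.blocks)
        (hBB' : {J | J ∈ D.fiber '' D.points ∧ J ⊆ B} =
          {J | J ∈ D.fiber '' D.points ∧ J ⊆ B'}) : B ⊆ B' := by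
      intro z hz
      have hzP := h.isOneDesign.block_subset B hB hz
      have : D.fiber z ∈ {J | J ∈ D.fiber '' D.points ∧ J ⊆ B} :=
        ⟨⟨z, hzP, rfl⟩, fiber_subset_block hB hz⟩
      rw [hBB'] at this
      exact this.2 (self_mem_fiber_methodTwo hzP)
    rintro B ⟨hB, -⟩ B' ⟨hB', -⟩ hBB'
    exact (hsub hB hBB').antisymm (hsub hB' hBB'.symm)

end IsFusedPair

/-! ### Nilpotent matrices of size two -/

namespace Matrix

variable {R : Type*} [Field R]

theorem isNilpotent_fin_two_entries {N : Matrix (Fin 2) (Fin 2) R} (hN : IsNilpotent N) :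
    N 1 1 = -N 0 0 ∧ N 0 0 * N 0 0 + N 0 1 * N 1 0 = 0 := by
  have h1 : N.trace = 0 := (isNilpotent_trace_of_isNilpotent hN).eq_zero
  have h2 : N.det = 0 := by
    obtain ⟨n, hn⟩ := hN
    refine (show IsNilpotent N.det from ⟨n, ?_⟩).eq_zero
    rcases n with _ | n
    · exact absurd hn (by simp)
    · rw [← det_pow, hn, det_zero]
  rw [trace_fin_two] at h1
  rw [det_fin_two] at h2
  have h3 : N 1 1 = -N 0 0 := by linear_combination h1
  rw [h3] at h2
  exact ⟨h3, by linear_combination -h2⟩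

theorem isNilpotent_fin_two_mul_self {N : Matrix (Fin 2) (Fin 2) R} (hN : IsNilpotent N) :
    N * N = 0 := by
  obtain ⟨h1, h2⟩ := isNilpotent_fin_two_entries hN
  ext i j
  fin_cases i <;> fin_cases j <;> simp [mul_apply, h1] <;> first | linear_combination h2 | ring

theorem isNilpotent_fin_two_det_scalar_add {N : Matrix (Fin 2) (Fin 2) R} (hN : IsNilpotent N)
    (a b : R) : (a • (1 : Matrix (Fin 2) (Fin 2) R) + b • N).det = a ^ 2 := by
  obtain ⟨h1, h2⟩ := isNilpotent_fin_two_entries hN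
  simp [det_fin_two, h1]
  linear_combination -b ^ 2 * h2

theorem isNilpotent_fin_two_exists_of_commute {N : Matrix (Fin 2) (Fin 2) R}
    (hN : IsNilpotent N) (hN0 : N ≠ 0) {B : Matrix (Fin 2) (Fin 2) R} (hB : B * N = N * B) :
    ∃ a b : R, B = a • (1 : Matrix (Fin 2) (Fin 2) R) + b • N := by
  obtain ⟨h1, h2⟩ := isNilpotent_fin_two_entries hN
  have e00 := congrFun (congrFun hB 0) 0
  have e01 := congrFun (congrFun hB 0) 1
  have e10 := congrFun (congrFun hB 1) 0
  simp only [mul_apply, Fin.sum_univ_two, h1] at e00 e01 e10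
  by_cases hb : N 0 1 = 0
  · have hc : N 1 0 ≠ 0 := by
      intro hc
      refine hN0 ?_
      have ha : N 0 0 = 0 := by simpa [hb] using h2
      ext i j
      fin_cases i <;> fin_cases j <;> simp [h1, ha, hb, hc]
    have ha : N 0 0 = 0 := by simpa [hb] using h2
    refine ⟨B 0 0, B 1 0 / N 1 0, ?_⟩
    simp only [ha, hb] at e00 e01 e10
    ext i j
    fin_cases i <;> fin_cases j <;> simp [h1, ha, hb, hc]
    · exact (mul_eq_zero.1 (by linear_combination e00 : B 0 1 * N 1 0 = 0)).resolve_right hc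
    · exact mul_right_cancel₀ hc (by linear_combination e10)
  · refine ⟨B 0 0 - B 0 1 / N 0 1 * N 0 0, B 0 1 / N 0 1, ?_⟩
    ext i j
    fin_cases i <;> fin_cases j <;> simp [h1, hb]
    · field_simp
      linear_combination -e00
    · field_simp
      linear_combination -e01

/-- Every nonzero nilpotent matrix of size two is conjugate to the standard one. The columns of
the conjugating matrix are `N v` and `v`, where `v` is a basis vector not killed by `N`. -/
theorem isNilpotent_fin_two_exists_conj {N : Matrix (Fin 2) (Fin 2) R}
    (hN : IsNilpotent N) (hN0 : N ≠ 0) :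
    ∃ P : GL (Fin 2) R, (P : Matrix (Fin 2) (Fin 2) R) * !![0, 1; 0, 0] =
      N * (P : Matrix (Fin 2) (Fin 2) R) := by
  obtain ⟨h1, h2⟩ := isNilpotent_fin_two_entries hN
  by_cases hc : N 1 0 = 0
  · have ha : N 0 0 = 0 := by simpa [hc] using h2
    have hb : N 0 1 ≠ 0 := by
      intro hb
      refine hN0 ?_
      ext i j
      fin_cases i <;> fin_cases j <;> simp [h1, ha, hb, hc]
    refine ⟨GeneralLinearGroup.mkOfDetNeZero !![N 0 1, 0; 0, 1] (by simpa using hb), ?_⟩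
    ext i j
    fin_cases i <;> fin_cases j <;>
      simp [GeneralLinearGroup.mkOfDetNeZero, mul_apply, h1, ha, hc]
  · refine ⟨GeneralLinearGroup.mkOfDetNeZero !![N 0 0, 1; N 1 0, 0] (by simpa using hc), ?_⟩
    ext i j
    fin_cases i <;> fin_cases j <;>
      simp [GeneralLinearGroup.mkOfDetNeZero, mul_apply, h1]
    · linear_combination -h2
    · ring

/-! ### Unipotent elements and their centralizers in `PGL(2, R)` -/

namespace SpecialLinearGroup

/-- The one-parameter group `b ↦ 1 + b N` in `SL(2, R)` attached to a nilpotent `N`. -/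
def oneAddSMul (N : Matrix (Fin 2) (Fin 2) R) (hN : IsNilpotent N) :
    Multiplicative R →* SpecialLinearGroup (Fin 2) R where
  toFun b := ⟨1 + b.toAdd • N, by
    simpa using isNilpotent_fin_two_det_scalar_add hN 1 b.toAdd⟩
  map_one' := by ext; simp
  map_mul' a b := by
    apply Subtype.ext
    refine Eq.trans ?_ (coe_mul _ _).symm
    change 1 + (a * b).toAdd • N = (1 + a.toAdd • N) * (1 + b.toAdd • N)
    simp only [toAdd_mul, add_smul, mul_add, add_mul, one_mul, mul_one, smul_mul_smul_comm,
      isNilpotent_fin_two_mul_self hN, smul_zero, add_zero, add_assoc]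

end SpecialLinearGroup

open Multiplicative (ofAdd)
open Matrix.SpecialLinearGroup (oneAddSMul)

theorem SpecialLinearGroup.coe_oneAddSMul (N : Matrix (Fin 2) (Fin 2) R) (hN : IsNilpotent N)
    (b : R) : (oneAddSMul N hN (ofAdd b) : Matrix (Fin 2) (Fin 2) R) = 1 + b • N := rfl

theorem SpecialLinearGroup.oneAddSMul_smul (N : Matrix (Fin 2) (Fin 2) R) (hN : IsNilpotent N)
    (a b : R) : oneAddSMul (a • N) (hN.smul a) (ofAdd b) = oneAddSMul N hN (ofAdd (a * b)) := by
  apply Subtype.ext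
  rw [coe_oneAddSMul, coe_oneAddSMul, smul_smul, mul_comm]

/-- If `B A B⁻¹ = r A` and `A` has nonzero trace, then comparing traces gives `r = 1`. -/
theorem eq_one_of_mul_eq_smul_mul {A : Matrix (Fin 2) (Fin 2) R} (hA : A.trace ≠ 0)
    (B : GL (Fin 2) R) {r : R} (h : B.1 * A = r • (A * B.1)) : r = 1 := by
  have h1 : (B⁻¹.1 * (B.1 * A)).trace = A.trace := by
    rw [← mul_assoc, ← Units.val_mul, inv_mul_cancel, Units.val_one, one_mul]
  rw [h, mul_smul_comm, trace_smul, ← mul_assoc, trace_mul_comm, ← mul_assoc, ← Units.val_mul,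
    mul_inv_cancel, Units.val_one, one_mul, smul_eq_mul] at h1
  exact mul_right_cancel₀ hA (h1.trans (one_mul _).symm)

theorem trace_oneAddSMul (N : Matrix (Fin 2) (Fin 2) R) (hN : IsNilpotent N) (b : R) :
    (oneAddSMul N hN (ofAdd b)).1.trace = 2 := by
  have h : N.trace = 0 := (isNilpotent_trace_of_isNilpotent hN).eq_zero
  rw [SpecialLinearGroup.coe_oneAddSMul, trace_add, trace_smul, h, trace_one]
  simp

namespace ProjGenLinGroup

/-- The image in `PGL(2, R)` of the one-parameter group `b ↦ 1 + b N`. -/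
noncomputable def unipotent (N : Matrix (Fin 2) (Fin 2) R) (hN : IsNilpotent N) :
    Multiplicative R →* ProjGenLinGroup (Fin 2) R :=
  SpecialLinearGroup.toPGL.comp (oneAddSMul N hN)

theorem mk_eq_mk_iff_smul {A B : GL (Fin 2) R} :
    mk A = mk B ↔ ∃ u : Rˣ, (u : R) • (A : Matrix (Fin 2) (Fin 2) R) = B := by
  rw [mk_eq_mk_iff]
  refine exists_congr fun u => ?_
  have h : (A : Matrix (Fin 2) (Fin 2) R) * Matrix.scalar (Fin 2) (u : R) =
      (u : R) • (A : Matrix (Fin 2) (Fin 2) R) := by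
    ext i j
    simp [mul_comm]
  rw [Units.ext_iff, Units.val_mul, GeneralLinearGroup.coe_scalar, h]

theorem unipotent_apply (N : Matrix (Fin 2) (Fin 2) R) (hN : IsNilpotent N) (b : R) :
    unipotent N hN (ofAdd b) = mk (SpecialLinearGroup.toGL (oneAddSMul N hN (ofAdd b))) := rfl

theorem coe_toGL_oneAddSMul (N : Matrix (Fin 2) (Fin 2) R) (hN : IsNilpotent N) (b : R) :
    (SpecialLinearGroup.toGL (oneAddSMul N hN (ofAdd b)) : Matrix (Fin 2) (Fin 2) R) =
      1 + b • N := rfl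

theorem unipotent_smul (N : Matrix (Fin 2) (Fin 2) R) (hN : IsNilpotent N)
    (a b : R) : unipotent (a • N) (hN.smul a) (ofAdd b) = unipotent N hN (ofAdd (a * b)) := by
  rw [unipotent_apply, SpecialLinearGroup.oneAddSMul_smul, unipotent_apply]

theorem unipotent_injective [NeZero (2 : R)] {N : Matrix (Fin 2) (Fin 2) R} (hN : IsNilpotent N)
    (hN0 : N ≠ 0) : Function.Injective (unipotent N hN) := by
  intro a b hab
  obtain ⟨a, rfl⟩ := ofAdd.surjective a
  obtain ⟨b, rfl⟩ := ofAdd.surjective b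
  rw [unipotent_apply, unipotent_apply, mk_eq_mk_iff_smul] at hab
  obtain ⟨u, hu⟩ := hab
  rw [coe_toGL_oneAddSMul, coe_toGL_oneAddSMul] at hu
  have hN1 : N.trace = 0 := (isNilpotent_trace_of_isNilpotent hN).eq_zero
  have htr := congrArg trace hu
  simp only [trace_smul, trace_add, trace_one, hN1, Fintype.card_fin, smul_eq_mul, mul_zero,
    add_zero, Nat.cast_ofNat] at htr
  rw [mul_right_cancel₀ (NeZero.ne (2 : R)) (htr.trans (one_mul _).symm), one_smul,
    add_right_inj] at hu
  rw [smul_left_injective R hN0 hu]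

/-- The centralizer of a nontrivial unipotent element of `PGL(2, R)` is its one-parameter group. -/
theorem commute_unipotent_iff [NeZero (2 : R)] {N : Matrix (Fin 2) (Fin 2) R}
    (hN : IsNilpotent N) (hN0 : N ≠ 0) {x : ProjGenLinGroup (Fin 2) R} :
    Commute x (unipotent N hN (ofAdd 1)) ↔ ∃ b : R, unipotent N hN (ofAdd b) = x := by
  constructor
  · intro h
    obtain ⟨B, rfl⟩ := mk_surjective x
    have h' := h.eq.symm
    rw [unipotent_apply, ← map_mul, ← map_mul, mk_eq_mk_iff_smul] at h'
    obtain ⟨u, hu⟩ := h'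
    rw [Units.val_mul, Units.val_mul] at hu
    have hu1 := eq_one_of_mul_eq_smul_mul
      (fun h0 => NeZero.ne (2 : R) ((trace_oneAddSMul N hN 1).symm.trans h0)) B hu.symm
    rw [hu1, one_smul, coe_toGL_oneAddSMul, one_smul, add_mul, mul_add, one_mul, mul_one,
      add_right_inj] at hu
    obtain ⟨a, b, hB⟩ := isNilpotent_fin_two_exists_of_commute hN hN0 hu.symm
    have ha : a ≠ 0 := by
      rintro rfl
      refine GeneralLinearGroup.det_ne_zero B ?_
      rw [hB, isNilpotent_fin_two_det_scalar_add hN]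
      simp
    refine ⟨a⁻¹ * b, ?_⟩
    rw [unipotent_apply, mk_eq_mk_iff_smul]
    refine ⟨Units.mk0 a ha, ?_⟩
    rw [coe_toGL_oneAddSMul, hB, Units.val_mk0, smul_add, smul_smul, mul_inv_cancel_left₀ ha]
  · rintro ⟨b, rfl⟩
    exact (Commute.all _ _).map (unipotent N hN)

/-- If `A ^ p` is scalar, it is `c ^ p` with `c` in the perfect field `R`, so that
`(A - c) ^ p = 0` and `c⁻¹ A` is unipotent. -/
theorem exists_unipotent_of_pow_eq_one [Finite R] (p : ℕ) [Fact p.Prime] [CharP R p]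
    {x : ProjGenLinGroup (Fin 2) R} (hx : x ^ p = 1) :
    ∃ (N : Matrix (Fin 2) (Fin 2) R) (hN : IsNilpotent N), unipotent N hN (ofAdd 1) = x := by
  obtain ⟨A, rfl⟩ := mk_surjective x
  rw [← map_pow, ← map_one mk] at hx
  obtain ⟨u, hu⟩ := mk_eq_mk_iff_smul.1 hx.symm
  rw [Units.val_one, Units.val_pow_eq_pow_val] at hu
  obtain ⟨c, hc⟩ := (bijective_frobenius R p).2 (u : R)
  rw [frobenius_def] at hc
  have hc0 : c ≠ 0 := by
    rintro rfl
    rw [zero_pow (Fact.out : p.Prime).ne_zero] at hc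
    exact u.ne_zero hc.symm
  have hN : IsNilpotent (c⁻¹ • (A : Matrix (Fin 2) (Fin 2) R) - 1) := by
    refine ⟨p, ?_⟩
    rw [sub_pow_char_of_commute p (Commute.one_right _), smul_pow, ← hu, smul_smul, one_pow, ← hc,
      ← mul_pow, inv_mul_cancel₀ hc0, one_pow, one_smul, sub_self]
  refine ⟨_, hN, ?_⟩
  rw [unipotent_apply, mk_eq_mk_iff_smul]
  refine ⟨Units.mk0 c hc0, ?_⟩
  rw [coe_toGL_oneAddSMul, one_smul, add_sub_cancel, Units.val_mk0, smul_smul,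
    mul_inv_cancel₀ hc0, one_smul]

theorem isConj_unipotent {N N' : Matrix (Fin 2) (Fin 2) R} (hN : IsNilpotent N) (hN0 : N ≠ 0)
    (hN' : IsNilpotent N') (hN0' : N' ≠ 0) :
    IsConj (unipotent N hN (ofAdd 1)) (unipotent N' hN' (ofAdd 1)) := by
  have hE : IsNilpotent (!![0, 1; 0, 0] : Matrix (Fin 2) (Fin 2) R) :=
    ⟨2, by ext i j; fin_cases i <;> fin_cases j <;> simp [pow_two, mul_apply]⟩
  have key {N : Matrix (Fin 2) (Fin 2) R} (hN : IsNilpotent N) (hN0 : N ≠ 0) :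
      IsConj (unipotent _ hE (ofAdd 1)) (unipotent N hN (ofAdd 1)) := by
    obtain ⟨P, hP⟩ := isNilpotent_fin_two_exists_conj hN hN0
    refine isConj_iff.2 ⟨mk P, mul_inv_eq_iff_eq_mul.2 ?_⟩
    rw [unipotent_apply, unipotent_apply, ← map_mul, ← map_mul]
    congr 1
    ext1
    rw [Units.val_mul, Units.val_mul, coe_toGL_oneAddSMul, coe_toGL_oneAddSMul, one_smul, one_smul,
      mul_add, add_mul, mul_one, one_mul, hP]
  exact (key hN hN0).symm.trans (key hN' hN0')

end ProjGenLinGroup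

/-! ### Orders of the groups -/

theorem card_GL_fin_two [Finite R] :
    Nat.card (GL (Fin 2) R) = (Nat.card R - 1) * (Nat.card R * (Nat.card R ^ 2 - 1)) := by
  have := Fintype.ofFinite R
  rw [card_GL_field, Fin.prod_univ_two, Nat.card_eq_fintype_card]
  obtain ⟨r, hr⟩ : ∃ r, Fintype.card R = r + 1 := ⟨Fintype.card R - 1, by
    have : 0 < Fintype.card R := Fintype.card_pos
    omega⟩
  rw [hr, Fin.val_zero, Fin.val_one, pow_zero, pow_one, Nat.add_sub_cancel,
    show (r + 1) ^ 2 - (r + 1) = r * (r + 1) from Nat.sub_eq_of_eq_add (by ring)]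
  ring

theorem card_ProjGenLinGroup_fin_two [Finite R] :
    Nat.card (ProjGenLinGroup (Fin 2) R) = Nat.card R * (Nat.card R ^ 2 - 1) := by
  have h1 := Subgroup.card_eq_card_quotient_mul_card_subgroup (Subgroup.center (GL (Fin 2) R))
  have h2 : Nat.card (Subgroup.center (GL (Fin 2) R)) = Nat.card R - 1 := by
    rw [GeneralLinearGroup.center_eq_range_scalar, ← Nat.card_units]
    refine Nat.card_range_of_injective (f := GeneralLinearGroup.scalar (Fin 2)) fun a b hab => ?_
    ext
    have := congrArg (fun A : GL (Fin 2) R => (A : Matrix (Fin 2) (Fin 2) R) 0 0) hab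
    simpa using this
  rw [h2, card_GL_fin_two, mul_comm] at h1
  have : 0 < Nat.card R - 1 := by have := Finite.one_lt_card (α := R); omega
  exact (Nat.eq_of_mul_eq_mul_right this h1).symm

theorem card_SpecialLinearGroup_fin_two [Finite R] :
    Nat.card (SpecialLinearGroup (Fin 2) R) = Nat.card R * (Nat.card R ^ 2 - 1) := by
  have h1 := Subgroup.card_mul_index (GeneralLinearGroup.det : GL (Fin 2) R →* Rˣ).ker
  have h3 : (GeneralLinearGroup.det : GL (Fin 2) R →* Rˣ).ker =
      (SpecialLinearGroup.toGL : SpecialLinearGroup (Fin 2) R →* GL (Fin 2) R).range := by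
    ext A
    rw [MonoidHom.mem_ker, MonoidHom.mem_range]
    constructor
    · intro hA
      exact ⟨⟨A, congrArg Units.val hA⟩, by ext1; rfl⟩
    · rintro ⟨B, rfl⟩
      ext1
      exact B.2
  rw [Subgroup.index_ker, MonoidHom.range_eq_top.2 GeneralLinearGroup.det_surjective,
    Subgroup.card_top, Nat.card_units, card_GL_fin_two, h3, mul_comm] at h1
  have : 0 < Nat.card R - 1 := by have := Finite.one_lt_card (α := R); omega
  have h4 := Nat.eq_of_mul_eq_mul_left this h1
  rw [← h4]
  exact (Nat.card_range_of_injective (f := SpecialLinearGroup.toGL)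
    SpecialLinearGroup.toGL_injective).symm

theorem two_mul_card_ProjectiveSpecialLinearGroup_fin_two [Finite R] [NeZero (2 : R)] :
    2 * Nat.card (ProjectiveSpecialLinearGroup (Fin 2) R) =
      Nat.card R * (Nat.card R ^ 2 - 1) := by
  have h1 := Subgroup.card_eq_card_quotient_mul_card_subgroup
    (Subgroup.center (SpecialLinearGroup (Fin 2) R))
  -- The center consists of the square roots of unity, namely `1` and `-1`.
  have h2 : Nat.card (Subgroup.center (SpecialLinearGroup (Fin 2) R)) = 2 := by
    rw [Nat.card_congr (SpecialLinearGroup.center_equiv_rootsOfUnity' (0 : Fin 2)).toEquiv,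
      Fintype.card_fin]
    refine (IsPrimitiveRoot.neg_one (R := R) (ringChar R) fun h => ?_).card_rootsOfUnity
    have := CharP.cast_eq_zero R (ringChar R)
    rw [h] at this
    exact NeZero.ne (2 : R) this
  rw [h2, card_SpecialLinearGroup_fin_two, mul_comm] at h1
  rw [mul_comm 2, mul_comm (Nat.card R)]
  exact h1.symm

end Matrix

/-! ### Unipotent elements of `PSL(2, F)` and of the subgroup `PGL(2, K)` -/

open Multiplicative (ofAdd)

namespace Matrix

namespace ProjectiveSpecialLinearGroup

variable {F : Type*} [Field F]

theorem toPGL_oneAddSMul (N : Matrix (Fin 2) (Fin 2) F) (hN : IsNilpotent N) (b : F) :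
    toPGL (QuotientGroup.mk (SpecialLinearGroup.oneAddSMul N hN (ofAdd b))) =
      ProjGenLinGroup.unipotent N hN (ofAdd b) := rfl

theorem exists_toPGL_eq_unipotent {g : ProjectiveSpecialLinearGroup (Fin 2) F} (hg : g ≠ 1)
    (hgu : PSLIsUnipotent g) :
    ∃ (N : Matrix (Fin 2) (Fin 2) F) (hN : IsNilpotent N), N ≠ 0 ∧
      toPGL g = ProjGenLinGroup.unipotent N hN (ofAdd 1) := by
  obtain ⟨A, hA, rfl⟩ := hgu
  refine ⟨_, hA, ?_, ?_⟩
  · intro h0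
    refine hg ?_
    rw [show A = 1 from Subtype.ext (sub_eq_zero.1 h0)]
    rfl
  · rw [← toPGL_oneAddSMul]
    congr 2
    apply Subtype.ext
    rw [SpecialLinearGroup.coe_oneAddSMul, one_smul, add_sub_cancel]

end ProjectiveSpecialLinearGroup

namespace ProjGenLinGroup

theorem unipotent_pow_char {R : Type*} [Field R] (p : ℕ) [CharP R p]
    (N : Matrix (Fin 2) (Fin 2) R) (hN : IsNilpotent N) (b : R) :
    unipotent N hN (ofAdd b) ^ p = 1 := by
  rw [← map_pow, ← ofAdd_nsmul, nsmul_eq_mul, CharP.cast_eq_zero, zero_mul, ofAdd_zero, map_one]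

theorem ne_zero_of_unipotent_ne_one {R : Type*} [Field R] {N : Matrix (Fin 2) (Fin 2) R}
    {hN : IsNilpotent N} {b : R} (h : unipotent N hN (ofAdd b) ≠ 1) : N ≠ 0 := by
  rintro rfl
  refine h ?_
  have h0 := unipotent_smul (0 : Matrix (Fin 2) (Fin 2) R) hN 0 b
  simp only [smul_zero, zero_mul, ofAdd_zero, map_one] at h0
  exact h0

variable {R : Type*} [Field R] [NeZero (2 : R)]

theorem card_centralizer_unipotent {N : Matrix (Fin 2) (Fin 2) R} (hN : IsNilpotent N)
    (hN0 : N ≠ 0) :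
    Nat.card (Subgroup.centralizer {unipotent N hN (ofAdd 1)}) = Nat.card R := by
  have : Subgroup.centralizer {unipotent N hN (ofAdd 1)} = (unipotent N hN).range := by
    ext x
    rw [Subgroup.mem_centralizer_singleton_iff, MonoidHom.mem_range]
    exact commute_unipotent_iff hN hN0
  rw [this]
  exact Nat.card_range_of_injective (unipotent_injective hN hN0)

/-- A nontrivial element `w` of the centralizer of a unipotent element is itself unipotent, so
its own centralizer is abelian. -/
theorem commute_of_commute_of_commute_unipotent {N : Matrix (Fin 2) (Fin 2) R}
    (hN : IsNilpotent N) (hN0 : N ≠ 0) {w a b : ProjGenLinGroup (Fin 2) R} (hw1 : w ≠ 1)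
    (hw : Commute w (unipotent N hN (ofAdd 1))) (ha : Commute a w) (hb : Commute b w) :
    Commute a b := by
  obtain ⟨c, rfl⟩ := (commute_unipotent_iff hN hN0).1 hw
  have hc : c ≠ 0 := by
    rintro rfl
    exact hw1 (map_one _)
  rw [← mul_one c, ← unipotent_smul] at ha hb
  obtain ⟨s, rfl⟩ := (commute_unipotent_iff (hN.smul c) (smul_ne_zero hc hN0)).1 ha
  obtain ⟨t, rfl⟩ := (commute_unipotent_iff (hN.smul c) (smul_ne_zero hc hN0)).1 hb
  exact (Commute.all _ _).map (unipotent _ _)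

theorem isConj_of_pow_char_eq_one {K : Type*} [Field K] [Finite K] (p : ℕ) [Fact p.Prime]
    [CharP K p] {x y : ProjGenLinGroup (Fin 2) K} (hx : x ^ p = 1) (hx1 : x ≠ 1)
    (hy : y ^ p = 1) (hy1 : y ≠ 1) : IsConj x y := by
  obtain ⟨N, hN, rfl⟩ := exists_unipotent_of_pow_eq_one p hx
  obtain ⟨N', hN', rfl⟩ := exists_unipotent_of_pow_eq_one p hy
  exact isConj_unipotent hN (ne_zero_of_unipotent_ne_one hx1) hN' (ne_zero_of_unipotent_ne_one hy1)

end ProjGenLinGroup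

end Matrix

/-- A maximal `PGL(2, q)` in `PSL(2, q ^ 2)` and a nontrivial unipotent element of it satisfy
the hypotheses of the abstract count. How `M` is embedded plays no role: unipotent elements of `M`
are recognized in `PGL(2, q)` as those of order `p`. -/
theorem IsFusedPair.of_PSL {F K : Type*} [Field F] [Finite F] [Field K] [Finite K]
    (q : ℕ) (hq : Odd q) (hK : Nat.card K = q) (hF : Nat.card F = q ^ 2)
    (M : Subgroup (Matrix.ProjectiveSpecialLinearGroup (Fin 2) F))
    (hM : IsCoatom M)
    (hMiso : Nonempty (M ≃* Matrix.ProjGenLinGroup (Fin 2) K))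
    (g : Matrix.ProjectiveSpecialLinearGroup (Fin 2) F)
    (hgM : g ∈ M) (hg : g ≠ 1) (hgu : PSLIsUnipotent g) : IsFusedPair M g q := by
  obtain ⟨e⟩ := hMiso
  have := Fintype.ofFinite K
  have := Fintype.ofFinite F
  obtain ⟨p, hpK, n, hp, hcard⟩ := FiniteField.card' K
  have : Fact p.Prime := ⟨hp⟩
  rw [← Nat.card_eq_fintype_card, hK] at hcard
  have hpF : CharP F p := charP_of_card_eq_prime_pow (f := n * 2) (by
    rw [← Nat.card_eq_fintype_card, hF, hcard, pow_mul])
  have hp2 : p ≠ 2 := by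
    rintro rfl
    exact Nat.not_even_iff_odd.2 hq (hcard ▸ (Nat.even_pow.2 ⟨even_two, n.ne_zero⟩))
  have : NeZero (2 : K) := ⟨Ring.two_ne_zero ((ringChar.eq K p).symm ▸ hp2)⟩
  have : NeZero (2 : F) := ⟨Ring.two_ne_zero ((ringChar.eq F p).symm ▸ hp2)⟩
  have hinj := Matrix.ProjectiveSpecialLinearGroup.toPGL_injective (n := Fin 2) (R := F)
  obtain ⟨N, hN, hN0, hgN⟩ := Matrix.ProjectiveSpecialLinearGroup.exists_toPGL_eq_unipotent hg hgu
  have hcomm {x y : Matrix.ProjectiveSpecialLinearGroup (Fin 2) F} :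
      Commute (Matrix.ProjectiveSpecialLinearGroup.toPGL x)
        (Matrix.ProjectiveSpecialLinearGroup.toPGL y) ↔ Commute x y :=
    commute_map_iff hinj
  have hgp : g ^ p = 1 := by
    refine hinj ?_
    rw [map_pow, hgN, Matrix.ProjGenLinGroup.unipotent_pow_char, map_one]
  have hgp' : e ⟨g, hgM⟩ ^ p = 1 := by
    rw [← map_pow, EmbeddingLike.map_eq_one_iff]
    exact Subtype.ext hgp
  have hg1 : e ⟨g, hgM⟩ ≠ 1 := by
    rw [Ne, EmbeddingLike.map_eq_one_iff]
    exact fun h => hg (congrArg Subtype.val h)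
  -- All elements of order `p` in `PGL(2, K)` are conjugate, so those of `M` fuse in `M`.
  have hfuse : ∀ x ∈ M, x ≠ 1 → x ^ p = 1 → ∃ m ∈ M, m * g * m⁻¹ = x := by
    intro x hx hx1 hxp
    have hc : IsConj (e ⟨g, hgM⟩) (e ⟨x, hx⟩) := by
      refine Matrix.ProjGenLinGroup.isConj_of_pow_char_eq_one p hgp' hg1 ?_ ?_
      · rw [← map_pow, EmbeddingLike.map_eq_one_iff]
        exact Subtype.ext hxp
      · rw [Ne, EmbeddingLike.map_eq_one_iff]
        exact fun h => hx1 (congrArg Subtype.val h)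
    obtain ⟨c, hc⟩ := isConj_iff.1 hc
    refine ⟨e.symm c, (e.symm c).2, ?_⟩
    have := congrArg (fun z => (e.symm z : Matrix.ProjectiveSpecialLinearGroup (Fin 2) F)) hc
    simpa using this
  obtain ⟨N', hN', hgN'⟩ := Matrix.ProjGenLinGroup.exists_unipotent_of_pow_eq_one p hgp'
  have hN0' : N' ≠ 0 := Matrix.ProjGenLinGroup.ne_zero_of_unipotent_ne_one (hgN' ▸ hg1)
  refine
    { one_lt := hK ▸ Finite.one_lt_card
      mem := hgM
      isCoatom := hM
      ne_one := hg
      commute_of_commute_commute := ?_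
      card_centralizer := ?_
      two_mul_card := ?_
      card_inf_centralizer := ?_
      card_subgroup := ?_
      exists_conj := ?_
      isConj_of_commute := ?_ }
  · intro w hw1 hw a b ha hb
    rw [← hcomm] at hw ha hb ⊢
    rw [hgN] at hw
    exact Matrix.ProjGenLinGroup.commute_of_commute_of_commute_unipotent hN hN0
      (fun h => hw1 (hinj (h.trans (map_one _).symm))) hw ha hb
  -- All of the centralizer of `g` in `PGL(2, F)` consists of images of matrices in `SL(2, F)`.
  · have hmap : (Subgroup.centralizer {g}).map Matrix.ProjectiveSpecialLinearGroup.toPGL =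
        Subgroup.centralizer {Matrix.ProjGenLinGroup.unipotent N hN (ofAdd 1)} := by
      ext x
      rw [Subgroup.mem_map, Subgroup.mem_centralizer_singleton_iff]
      constructor
      · rintro ⟨y, hy, rfl⟩
        rw [Subgroup.mem_centralizer_singleton_iff] at hy
        rw [← hgN]
        exact hcomm.2 hy
      · intro hx
        obtain ⟨b, rfl⟩ := (Matrix.ProjGenLinGroup.commute_unipotent_iff hN hN0).1 hx
        rw [← hgN] at hx
        let y := Matrix.SpecialLinearGroup.oneAddSMul N hN (ofAdd b)
        exact ⟨QuotientGroup.mk y, Subgroup.mem_centralizer_singleton_iff.2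
          ((hcomm (x := QuotientGroup.mk y)).1 hx),
          Matrix.ProjectiveSpecialLinearGroup.toPGL_oneAddSMul N hN b⟩
    rw [← hF, ← Matrix.ProjGenLinGroup.card_centralizer_unipotent hN hN0, ← hmap,
      Subgroup.card_map_of_injective hinj]
  · rw [Matrix.two_mul_card_ProjectiveSpecialLinearGroup_fin_two, hF, ← pow_mul]
  · have hmap : (Subgroup.centralizer {e ⟨g, hgM⟩}).map (M.subtype.comp e.symm.toMonoidHom) =
        M ⊓ Subgroup.centralizer {g} := by
      ext x
      rw [Subgroup.mem_map, Subgroup.mem_inf, Subgroup.mem_centralizer_singleton_iff]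
      constructor
      · rintro ⟨y, hy, rfl⟩
        obtain ⟨z, rfl⟩ := e.surjective y
        rw [Subgroup.mem_centralizer_singleton_iff, ← map_mul, ← map_mul,
          EmbeddingLike.apply_eq_iff_eq] at hy
        simpa using congrArg Subtype.val hy
      · rintro ⟨hx, hxg⟩
        refine ⟨e ⟨x, hx⟩, ?_, by simp⟩
        rw [Subgroup.mem_centralizer_singleton_iff, ← map_mul, ← map_mul]
        exact congrArg e (Subtype.ext hxg)
    rw [← hmap, Subgroup.card_map_of_injective
        (show Function.Injective (M.subtype.comp e.symm.toMonoidHom) from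
          M.subtype_injective.comp e.symm.injective),
      ← hgN', Matrix.ProjGenLinGroup.card_centralizer_unipotent hN' hN0', hK]
  · rw [Nat.card_congr e.toEquiv, Matrix.card_ProjGenLinGroup_fin_two, hK]
  · intro x hx hgx
    refine hfuse x hx ?_ ?_
    · rintro rfl
      exact hg (isConj_one_left.1 hgx)
    · obtain ⟨c, rfl⟩ := isConj_iff.1 hgx
      rw [conj_pow, hgp, mul_one, mul_inv_cancel]
  · intro x hx hx1 hxg
    have hxp : x ^ p = 1 := by
      rw [← hcomm, hgN, Matrix.ProjGenLinGroup.commute_unipotent_iff hN hN0] at hxg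
      obtain ⟨b, hb⟩ := hxg
      refine hinj ?_
      rw [map_pow, ← hb, Matrix.ProjGenLinGroup.unipotent_pow_char, map_one]
    obtain ⟨m, -, hm⟩ := hfuse x hx hx1 hxp
    exact isConj_iff.2 ⟨m, hm⟩

theorem mainTheorem8 {F K : Type*} [Field F] [Finite F] [Field K] [Finite K]
    (q : ℕ) (hq : Odd q) (hK : Nat.card K = q) (hF : Nat.card F = q ^ 2)
    (M : Subgroup (Matrix.ProjectiveSpecialLinearGroup (Fin 2) F))
    (hM : IsCoatom M)
    (hMiso : Nonempty (M ≃* Matrix.ProjGenLinGroup (Fin 2) K))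
    (g : Matrix.ProjectiveSpecialLinearGroup (Fin 2) F)
    (hgM : g ∈ M) (hg : g ≠ 1) (hgu : PSLIsUnipotent g) :
    (methodTwo M g).IsOneDesign ((q ^ 4 - 1) / 2) (q ^ 2 - 1) q ∧
    (∀ x ∈ conjugatesOf g, ((methodTwo M g).fiber x).ncard = q - 1) ∧
    (∀ x ∈ (M : Set (Matrix.ProjectiveSpecialLinearGroup (Fin 2) F)) ∩ conjugatesOf g,
      (methodTwo M g).fiber x =
        ((M ⊓ Subgroup.centralizer {x} :
          Subgroup (Matrix.ProjectiveSpecialLinearGroup (Fin 2) F)) :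
            Set (Matrix.ProjectiveSpecialLinearGroup (Fin 2) F)) ∩ conjugatesOf g) ∧
    (methodTwo M g).reduced.IsOneDesign ((q ^ 2 + 1) * (q + 1) / 2) (q + 1) q := by
  have h := IsFusedPair.of_PSL q hq hK hF M hM hMiso g hgM hg hgu
  exact ⟨h.isOneDesign, fun x hx => h.ncard_fiber hx, fun x hx => h.fiber_eq hx.1 hx.2,
    h.reduced_isOneDesign⟩
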